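/- Let $q = 3^m$ with $m \ge 1$, let $n = 3^h s \ge 2$ with $h \ge 0$, $s \ge 1$ and $\gcd(s,3)=1$, regard $\mathbb{F}_q$ as a subfield of $\mathbb{F}_{q^n}$, and let $a \in \mathbb{F}_q^*$. Let $\omega \in \mathbb{C}$ be a primitive cube root of unity, let $\mathrm{Tr}$ be the trace from $\mathbb{F}_q$ to $\mathbb{F}_3$ and $\mathrm{Tr}_{q^n\to q}$ the trace from $\mathbb{F}_{q^n}$ to $\mathbb{F}_q$. Define $$K(a)=\sum_{x\in\mathbb{F}_q}\omega^{\mathrm{Tr}(x+a/x)},\qquad K_n(a)=\sum_{x\in\mathbb{F}_{q^n}}\omega^{\mathrm{Tr}(\mathrm{Tr}_{q^n\to q}(x+a/x))},$$ where $a/0$ is understood as $0$. Then $K(a)$ and $K_n(a)$ are rational integers. Let $H(a)$ be the largest integer $k$ such that $3^k$ divides $K(a)$, with the convention $H(a)=m$ if $K(a)=0$, and let $H_n(a)$ be the largest integer $k$ such that $3^k$ divides $K_n(a)$, with the corresponding convention $H_n(a)=mn$ if $K_n(a)=0$. Then $$H_n(a)=H(a)+h.$$ -/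

import Mathlib

noncomputable section

/-- The additive character `e(x) = ω ^ Tr(x)` of a finite field `F` of characteristic `3`, where
`Tr` is the trace to the prime field and `ω` is a cube root of unity. -/
def kloostermanChar (ω : ℂ) {F : Type*} [Field F] [Algebra (ZMod 3) F] (x : F) : ℂ :=
  ω ^ (Algebra.trace (ZMod 3) F x).val

/-- The lifted additive character `e_n(y) = ω ^ Tr(Tr_{L/F}(y))` of an extension `L` of `F`. -/
def kloostermanCharLift (ω : ℂ) (F : Type*) {L : Type*} [Field F] [Algebra (ZMod 3) F]
    [Field L] [Algebra F L] (y : L) : ℂ :=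
  kloostermanChar ω (Algebra.trace F L y)

/-- The Kloosterman sum `K(a) = ∑_{x ∈ F} e(x + a / x)`. The sum includes `x = 0`, with the
convention `a / 0 = 0`, so that this term equals `1`. -/
def kloostermanSum (ω : ℂ) {F : Type*} [Field F] [Fintype F] [Algebra (ZMod 3) F] (a : F) : ℂ :=
  ∑ x : F, kloostermanChar ω (x + a / x)

/-- The lifted Kloosterman sum `K_n(a) = ∑_{x ∈ L} e_n(x + a / x)`, for `a ∈ F` and an extension
`L` of `F`. The sum includes `x = 0`, with the convention `a / 0 = 0`. -/
def kloostermanSumLift (ω : ℂ) {F : Type*} (L : Type*) [Field F] [Algebra (ZMod 3) F]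
    [Field L] [Fintype L] [Algebra F L] (a : F) : ℂ :=
  ∑ x : L, kloostermanCharLift ω F (x + algebraMap F L a / x)

open Classical in
/-- The exponent of the largest power of `3` that divides the rational integer `z`, regarded as a
complex number; by convention it is `d` for `z = 0`. -/
def threeExponent (d : ℕ) (z : ℂ) : ℕ :=
  if z = 0 then d else sSup {k : ℕ | ∃ c : ℤ, z = 3 ^ k * (c : ℂ)}

end

noncomputable section

open Polynomial Finset UniqueFactorizationMonoid IntermediateField

/-! Write q = |F|, K = K(a), K_n = K_n(a). The function χ = `kloostermanPolyChar ψ a` is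
multiplicative on monic polynomials, and its L-function ∑ χ(f) T^(deg f) is the polynomial 1 + (K -
1)T + qT² = (1 - αT)(1 - βT). The logarithmic derivative of its Euler product has as n-th
coefficient a sum over L, grouped by minimal polynomials (`sum_trace_eq_primePowerSum`). Comparing
the two gives K_n = 1 - α^n - β^n (`kloostermanSumLift_eq_one_sub_powerSumSeq`).

As αβ = q, it follows that K + q = (1 - α)(1 - β) and K_n + q^n = (1 - α^n)(1 - β^n). Since 3
divides K, Hensel's lemma puts α and β in ℤ_3 with α ≡ 1 and β ≡ 0 mod 3. The factors in β are
units, and lifting the exponent adds exactly h to the valuation of 1 - α (`three_pow_dvd_iff`).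

The shift by q also absorbs the convention at zero: since -q < K ≤ q, the valuation of K + q is H(a)
whether or not K = 0, and likewise for K_n (`le_threeExponent_iff`). -/

open Classical in
theorem card_filter_pow_dvd_eq_count {F : Type*} [Field F] {P f : F[X]} (hP : P.Monic)
    (hi : Irreducible P) (hf : f ≠ 0) {n : ℕ} (hn : f.natDegree ≤ n) :
    ((Icc 1 n).filter fun j => P ^ j ∣ f).card = (normalizedFactors f).count P := by
  have key : ∀ j : ℕ, P ^ j ∣ f ↔ j ≤ (normalizedFactors f).count P := by
    intro j
    rw [pow_dvd_iff_le_emultiplicity, emultiplicity_eq_count_normalizedFactors hi hf,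
      hP.normalize_eq_self]
    exact Nat.cast_le
  have hle : (normalizedFactors f).count P ≤ n := by
    have h := natDegree_le_of_dvd ((key _).2 le_rfl) hf
    rw [natDegree_pow] at h
    have := hi.natDegree_pos
    nlinarith
  have : ((Icc 1 n).filter fun j => P ^ j ∣ f) = Icc 1 ((normalizedFactors f).count P) := by
    ext j
    simp only [mem_filter, mem_Icc, key]
    omega
  rw [this, Nat.card_Icc]
  omega

theorem map_pow_of_monic {F R : Type*} [Field F] [CommRing R] {χ : F[X] → R} (hone : χ 1 = 1)
    (hmul : ∀ f g : F[X], f.Monic → g.Monic → χ (f * g) = χ f * χ g) {g : F[X]} (hg : g.Monic)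
    (j : ℕ) : χ (g ^ j) = χ g ^ j := by
  induction j with
  | zero => simp [hone]
  | succ j ih => rw [pow_succ, hmul _ _ (hg.pow j) hg, ih, pow_succ]

/-! ### Monic polynomials over a finite field and unique factorization. -/

section MonicPolynomials

variable {F : Type*} [Field F] [Finite F]

theorem finite_monic_natDegree_eq (n : ℕ) : {p : F[X] | p.Monic ∧ p.natDegree = n}.Finite :=
  (Finite.of_equiv (Fin n → F)
    ((monicEquivDegreeLT n).trans (degreeLTEquiv F n).toEquiv).symm :
      Finite {p : F[X] // p.Monic ∧ p.natDegree = n})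

variable (F) in
/-- The monic polynomials of degree `n` over a finite field. -/
def monicOfDegree (n : ℕ) : Finset F[X] := (finite_monic_natDegree_eq n).toFinset

@[simp]
theorem mem_monicOfDegree {n : ℕ} {p : F[X]} :
    p ∈ monicOfDegree F n ↔ p.Monic ∧ p.natDegree = n := by
  simp [monicOfDegree]

open Classical in
variable (F) in
/-- The monic irreducible polynomials of degree `n` over a finite field. -/
def irreducibleOfDegree (n : ℕ) : Finset F[X] := (monicOfDegree F n).filter Irreducible

@[simp]
theorem mem_irreducibleOfDegree {n : ℕ} {p : F[X]} :
    p ∈ irreducibleOfDegree F n ↔ (p.Monic ∧ p.natDegree = n) ∧ Irreducible p := by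
  simp [irreducibleOfDegree]

open Classical in
theorem sum_natDegree_mul_count {f : F[X]} (hf : f.Monic) :
    ∑ d ∈ Icc 1 f.natDegree, ∑ P ∈ irreducibleOfDegree F d,
      d * (normalizedFactors f).count P = f.natDegree := by
  have hf0 : f ≠ 0 := hf.ne_zero
  have hprod : (normalizedFactors f).prod = f := by
    have := leadingCoeff_mul_prod_normalizedFactors f
    rwa [hf.leadingCoeff, C_1, one_mul] at this
  have hmon : ∀ P ∈ normalizedFactors f, P.Monic := fun P hP =>
    (normalize_eq_self_iff_monic (irreducible_of_normalized_factor P hP).ne_zero).1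
      (normalize_normalized_factor P hP)
  have hdeg : ((normalizedFactors f).map natDegree).sum = f.natDegree := by
    rw [← natDegree_multiset_prod_of_monic _ hmon, hprod]
  conv_rhs => rw [← hdeg, sum_multiset_map_count]
  have hmaps : ∀ P ∈ (normalizedFactors f).toFinset, P.natDegree ∈ Icc 1 f.natDegree := by
    intro P hP
    rw [Multiset.mem_toFinset] at hP
    exact mem_Icc.2 ⟨(irreducible_of_normalized_factor P hP).natDegree_pos,
      natDegree_le_of_dvd (dvd_of_mem_normalizedFactors hP) hf0⟩
  rw [← sum_fiberwise_of_maps_to hmaps]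
  refine sum_congr rfl fun d _ => ?_
  symm
  refine (sum_subset (s₂ := irreducibleOfDegree F d) ?_ ?_).trans (sum_congr rfl ?_)
  · intro P hP
    simp only [mem_filter, Multiset.mem_toFinset] at hP
    exact mem_irreducibleOfDegree.2 ⟨⟨hmon P hP.1, hP.2⟩,
      irreducible_of_normalized_factor P hP.1⟩
  · intro P hP hP'
    have : P ∉ normalizedFactors f := by
      intro h
      exact hP' (mem_filter.2 ⟨Multiset.mem_toFinset.2 h, (mem_irreducibleOfDegree.1 hP).1.2⟩)
    simp [Multiset.count_eq_zero_of_notMem this]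
  · intro P hP
    rw [(mem_irreducibleOfDegree.1 hP).1.2, smul_eq_mul, mul_comm]

end MonicPolynomials

/-! ### Logarithmic derivative of an Euler product, in coefficients. -/

section LogDerivative

variable {F : Type*} [Field F] [Finite F] {R : Type*} [CommRing R]

/-- The coefficient of `T ^ n` in the `L`-function of `χ`. -/
def monicSum (χ : F[X] → R) (n : ℕ) : R := ∑ f ∈ monicOfDegree F n, χ f

/-- The coefficient of `T ^ n` in `T L'(T) / L(T)` for the `L`-function of `χ`. -/
def primePowerSum (χ : F[X] → R) (n : ℕ) : R :=
  ∑ x ∈ n.divisorsAntidiagonal, ∑ P ∈ irreducibleOfDegree F x.1, (x.1 : R) * χ P ^ x.2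

theorem sum_Icc_Icc_eq_sum_divisorsAntidiagonal (G : ℕ → ℕ → R) (n : ℕ) :
    (∑ d ∈ Icc 1 n, ∑ j ∈ Icc 1 n, if d * j ≤ n then G d j else 0) =
      ∑ k ∈ Icc 1 n, ∑ x ∈ k.divisorsAntidiagonal, G x.1 x.2 := by
  rw [← sum_product', ← sum_filter]
  have hmaps : ∀ x ∈ ((Icc 1 n) ×ˢ (Icc 1 n)).filter (fun x : ℕ × ℕ => x.1 * x.2 ≤ n),
      x.1 * x.2 ∈ Icc 1 n := by
    intro x hx
    simp only [mem_filter, mem_product, mem_Icc] at hx ⊢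
    exact ⟨Nat.mul_pos hx.1.1.1 hx.1.2.1, hx.2⟩
  rw [← sum_fiberwise_of_maps_to hmaps]
  refine sum_congr rfl fun k hk => sum_congr ?_ fun _ _ => rfl
  ext ⟨d, j⟩
  simp only [mem_filter, mem_product, mem_Icc, Nat.mem_divisorsAntidiagonal] at hk ⊢
  constructor
  · rintro ⟨_, rfl⟩
    exact ⟨rfl, by omega⟩
  · rintro ⟨rfl, h0⟩
    have hd : 0 < d := Nat.pos_of_ne_zero (by rintro rfl; simp at h0)
    have hj : 0 < j := Nat.pos_of_ne_zero (by rintro rfl; simp at h0)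
    have := Nat.le_mul_of_pos_right d hj
    have := Nat.le_mul_of_pos_left j hd
    exact ⟨⟨⟨⟨hd, by omega⟩, hj, by omega⟩, hk.2⟩, rfl⟩

open Classical in
theorem sum_monicOfDegree_filter_dvd {χ : F[X] → R}
    (hmul : ∀ f g : F[X], f.Monic → g.Monic → χ (f * g) = χ f * χ g) {g : F[X]} (hg : g.Monic)
    (n : ℕ) :
    ∑ f ∈ (monicOfDegree F n).filter (g ∣ ·), χ f =
      if g.natDegree ≤ n then χ g * monicSum χ (n - g.natDegree) else 0 := by
  split_ifs with h
  · rw [monicSum, mul_sum]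
    symm
    refine sum_bij (fun f _ => g * f) ?_ ?_ ?_ ?_
    · intro f hf
      rw [mem_monicOfDegree] at hf
      simp only [mem_filter, mem_monicOfDegree]
      exact ⟨⟨hg.mul hf.1, by rw [hg.natDegree_mul hf.1]; omega⟩, dvd_mul_right _ _⟩
    · intro f _ f' _ hff
      exact mul_left_cancel₀ hg.ne_zero hff
    · intro f hf
      simp only [mem_filter, mem_monicOfDegree] at hf
      obtain ⟨⟨hf1, hf2⟩, f', rfl⟩ := hf
      have hf' := hg.of_mul_monic_left hf1
      refine ⟨f', mem_monicOfDegree.2 ⟨hf', ?_⟩, rfl⟩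
      rw [hg.natDegree_mul hf'] at hf2
      omega
    · intro f hf
      exact (hmul g f hg (mem_monicOfDegree.1 hf).1).symm
  · refine sum_eq_zero fun f hf => ?_
    simp only [mem_filter, mem_monicOfDegree] at hf
    exact absurd (hf.1.2 ▸ natDegree_le_of_dvd hf.2 hf.1.1.ne_zero) h

/-- The identity `T L'(T) = L(T) * (T L'(T) / L(T))` of power series, in coefficients. -/
theorem natCast_mul_monicSum {χ : F[X] → R} (hone : χ 1 = 1)
    (hmul : ∀ f g : F[X], f.Monic → g.Monic → χ (f * g) = χ f * χ g) (n : ℕ) :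
    (n : R) * monicSum χ n = ∑ k ∈ Icc 1 n, primePowerSum χ k * monicSum χ (n - k) := by
  classical
  -- Double counting: n = deg f is the sum of deg P over all pairs (P, j), j ≥ 1, with P ^ j
  -- dividing f.
  have h1 : ∀ f ∈ monicOfDegree F n, (n : R) * χ f =
      ∑ d ∈ Icc 1 n, ∑ P ∈ irreducibleOfDegree F d, ∑ j ∈ Icc 1 n,
        if P ^ j ∣ f then (d : R) * χ f else 0 := by
    intro f hf
    obtain ⟨hf1, hf2⟩ := mem_monicOfDegree.1 hf
    have hn := sum_natDegree_mul_count hf1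
    rw [hf2] at hn
    conv_lhs => rw [← hn, Nat.cast_sum, sum_mul]
    refine sum_congr rfl fun d _ => ?_
    rw [Nat.cast_sum, sum_mul]
    refine sum_congr rfl fun P hP => ?_
    obtain ⟨⟨hP1, _⟩, hP3⟩ := mem_irreducibleOfDegree.1 hP
    rw [← card_filter_pow_dvd_eq_count hP1 hP3 hf1.ne_zero hf2.le, ← sum_filter, sum_const,
      nsmul_eq_mul]
    push_cast
    ring
  have h2 : ∀ d, ∀ P ∈ irreducibleOfDegree F d, ∀ j,
      ∑ f ∈ monicOfDegree F n, (if P ^ j ∣ f then (d : R) * χ f else 0) =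
        if d * j ≤ n then (d : R) * χ P ^ j * monicSum χ (n - d * j) else 0 := by
    intro d P hP j
    obtain ⟨⟨hP1, hP2⟩, hP3⟩ := mem_irreducibleOfDegree.1 hP
    rw [← sum_filter, ← mul_sum, sum_monicOfDegree_filter_dvd hmul (hP1.pow j),
      map_pow_of_monic hone hmul hP1, natDegree_pow, hP2, mul_comm j d]
    split_ifs <;> ring
  calc (n : R) * monicSum χ n
      = ∑ d ∈ Icc 1 n, ∑ P ∈ irreducibleOfDegree F d, ∑ j ∈ Icc 1 n,
          ∑ f ∈ monicOfDegree F n, if P ^ j ∣ f then (d : R) * χ f else 0 := by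
        rw [monicSum, mul_sum, sum_congr rfl h1, sum_comm]
        refine sum_congr rfl fun d _ => ?_
        rw [sum_comm]
        refine sum_congr rfl fun P _ => ?_
        rw [sum_comm]
    _ = ∑ d ∈ Icc 1 n, ∑ j ∈ Icc 1 n, if d * j ≤ n then
          (∑ P ∈ irreducibleOfDegree F d, (d : R) * χ P ^ j) * monicSum χ (n - d * j) else 0 := by
        refine sum_congr rfl fun d _ => ?_
        rw [sum_comm]
        refine sum_congr rfl fun j _ => ?_
        rw [sum_congr rfl fun P hP => h2 d P hP j]
        split_ifs
        · rw [sum_mul]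
        · simp
    _ = _ := by
        rw [sum_Icc_Icc_eq_sum_divisorsAntidiagonal fun d j =>
          (∑ P ∈ irreducibleOfDegree F d, (d : R) * χ P ^ j) * monicSum χ (n - d * j)]
        refine sum_congr rfl fun k _ => ?_
        rw [primePowerSum, sum_mul]
        refine sum_congr rfl fun x hx => ?_
        rw [(Nat.mem_divisorsAntidiagonal.1 hx).1]

end LogDerivative

/-! ### Newton's identities for a quadratic L-function. -/

section PowerSums

variable {R S : Type*} [CommRing R] [CommRing S]

/-- The power sums `α ^ n + β ^ n` as polynomials in `t = α + β` and `q = α * β`. -/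
def powerSumSeq (t q : R) : ℕ → R
  | 0 => 2
  | 1 => t
  | n + 2 => t * powerSumSeq t q (n + 1) - q * powerSumSeq t q n

theorem powerSumSeq_add_mul (α β : R) (n : ℕ) :
    powerSumSeq (α + β) (α * β) n = α ^ n + β ^ n := by
  induction n using Nat.twoStepInduction with
  | zero => simp [powerSumSeq, one_add_one_eq_two]
  | one => simp [powerSumSeq]
  | more n h1 h2 => rw [powerSumSeq, h1, h2]; ring

theorem map_powerSumSeq (φ : R →+* S) (t q : R) (n : ℕ) :
    φ (powerSumSeq t q n) = powerSumSeq (φ t) (φ q) n := by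
  induction n using Nat.twoStepInduction with
  | zero => simp only [powerSumSeq, map_ofNat]
  | one => simp [powerSumSeq]
  | more n h1 h2 => simp [powerSumSeq, h1, h2]

/-- If 1 + S₁T + S₂T² = (1 - αT)(1 - βT), then TL'/L = -∑ (α^n + β^n) T^n. Working with the
recurrence avoids having to adjoin α and β to `R`. -/
theorem eq_neg_powerSumSeq_of_newton {S P : ℕ → R} (h0 : S 0 = 1) (h3 : ∀ n, 3 ≤ n → S n = 0)
    (h : ∀ n : ℕ, (n : R) * S n = ∑ k ∈ Icc 1 n, P k * S (n - k)) {n : ℕ} (hn : 1 ≤ n) :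
    P n = -powerSumSeq (-S 1) (S 2) n := by
  have e1 : P 1 = S 1 := by
    have := h 1
    simpa [h0] using this.symm
  have e2 : P 2 = 2 * S 2 - S 1 * S 1 := by
    have := h 2
    rw [sum_Icc_succ_top (by norm_num)] at this
    simp [h0, e1] at this
    rw [this]; ring
  have e3 : ∀ n, P (n + 3) = -(S 1 * P (n + 2) + S 2 * P (n + 1)) := by
    intro n
    have := h (n + 3)
    rw [h3 _ (by omega), mul_zero, sum_Icc_succ_top (by omega), sum_Icc_succ_top (by omega),
      sum_Icc_succ_top (by omega), sum_eq_zero] at this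
    · rw [show n + 3 - (n + 2 + 1) = 0 by omega, show n + 3 - (n + 1 + 1) = 1 by omega,
        show n + 3 - (n + 1) = 2 by omega, h0] at this
      linear_combination -this
    · intro k hk
      rw [mem_Icc] at hk
      rw [h3 _ (by omega), mul_zero]
  obtain ⟨n, rfl⟩ : ∃ k, n = k + 1 := ⟨n - 1, by omega⟩
  induction n using Nat.twoStepInduction with
  | zero => simp [powerSumSeq, e1]
  | one => simp [powerSumSeq, e2]; ring
  | more n h1 h2 =>
    rw [e3, h1 (by omega), h2 (by omega)]
    simp only [powerSumSeq]; ring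

end PowerSums

/-! ### The L-function of the Kloosterman character. -/

section PolynomialChar

variable {F : Type*} [Field F] {R : Type*} [CommRing R]

open Classical in
/-- The multiplicative function on monic polynomials `f` with `f(0) ≠ 0` whose value at `f` is
`ψ (∑ r + a * ∑ r⁻¹)`, the sums being over the roots `r` of `f`. -/
def kloostermanPolyChar (ψ : AddChar F R) (a : F) (f : F[X]) : R :=
  if f.coeff 0 = 0 then 0 else ψ (-(f.nextCoeff + a * (f.coeff 1 / f.coeff 0)))

theorem kloostermanPolyChar_one (ψ : AddChar F R) (a : F) : kloostermanPolyChar ψ a 1 = 1 := by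
  simp [kloostermanPolyChar, nextCoeff, coeff_one]

/-- Both `nextCoeff` and the ratio of the coefficients of X and 1 turn products into sums, and ψ
turns sums back into products. -/
theorem kloostermanPolyChar_mul (ψ : AddChar F R) (a : F) {f g : F[X]} (hf : f.Monic)
    (hg : g.Monic) :
    kloostermanPolyChar ψ a (f * g) = kloostermanPolyChar ψ a f * kloostermanPolyChar ψ a g := by
  unfold kloostermanPolyChar
  rw [mul_coeff_zero]
  by_cases h : f.coeff 0 = 0
  · simp [h]
  by_cases h' : g.coeff 0 = 0
  · simp [h']
  rw [if_neg (mul_ne_zero h h'), if_neg h, if_neg h', ← AddChar.map_add_eq_mul,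
    hf.nextCoeff_mul hg, mul_coeff_one]
  congr 1
  field_simp
  ring

theorem nextCoeff_X_sq_add (b c : F) : (X ^ 2 + C b * X + C c : F[X]).nextCoeff = b := by
  have : (X ^ 2 + C b * X + C c : F[X]).natDegree = 2 := by compute_degree!
  rw [nextCoeff_of_natDegree_pos (by omega), this]
  simp [coeff_C, coeff_X_pow]

theorem kloostermanPolyChar_X_add_C (ψ : AddChar F R) (a c : F) [Decidable (c = 0)] :
    kloostermanPolyChar ψ a (X + C c) = if c = 0 then 0 else ψ (-(c + a / c)) := by
  simp [kloostermanPolyChar, nextCoeff_X_add_C, coeff_C, div_eq_mul_inv]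

theorem kloostermanPolyChar_X_sq_add (ψ : AddChar F R) (a b c : F) [Decidable (c = 0)] :
    kloostermanPolyChar ψ a (X ^ 2 + C b * X + C c) =
      if c = 0 then 0 else ψ (b * -(1 + a / c)) := by
  rw [kloostermanPolyChar, nextCoeff_X_sq_add]
  simp only [coeff_add, coeff_X_pow, coeff_C_mul, coeff_X, coeff_C]
  norm_num
  congr 2
  ring_nf

variable [Fintype F]

theorem monicSum_zero {χ : F[X] → R} (hone : χ 1 = 1) : monicSum χ 0 = 1 := by
  have : monicOfDegree F 0 = {1} := by
    ext f
    simp only [mem_monicOfDegree, mem_singleton]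
    constructor
    · rintro ⟨h1, h2⟩
      exact h1.natDegree_eq_zero.1 h2
    · rintro rfl
      simp
  rw [monicSum, this, sum_singleton, hone]

theorem monicSum_one_eq (χ : F[X] → R) : monicSum χ 1 = ∑ c : F, χ (X + C c) := by
  symm
  refine sum_bij (fun c _ => X + C c) ?_ ?_ ?_ fun _ _ => rfl
  · intro c _
    simp [monic_X_add_C]
  · intro c _ d _ h
    simpa using h
  · intro f hf
    rw [mem_monicOfDegree] at hf
    refine ⟨f.coeff 0, mem_univ _, ?_⟩
    rw [hf.1.eq_X_add_C hf.2]
    simp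

theorem monicSum_two_eq (χ : F[X] → R) :
    monicSum χ 2 = ∑ c : F, ∑ b : F, χ (X ^ 2 + C b * X + C c) := by
  rw [← sum_product']
  symm
  refine sum_bij (fun x _ => X ^ 2 + C x.2 * X + C x.1) ?_ ?_ ?_ fun _ _ => rfl
  · intro x _
    rw [mem_monicOfDegree]
    exact ⟨by monicity!, by compute_degree!⟩
  · rintro ⟨c, b⟩ _ ⟨c', b'⟩ _ h
    have h0 := congrArg (fun p => coeff p 0) h
    have h1 := congrArg (fun p => coeff p 1) h
    simp [coeff_X, coeff_C, coeff_X_pow] at h0 h1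
    rw [h0, h1]
  · intro f hf
    rw [mem_monicOfDegree] at hf
    refine ⟨(f.coeff 0, f.coeff 1), mem_univ _, ?_⟩
    have h2 : f.coeff 2 = 1 := by
      have := hf.1.coeff_natDegree
      rwa [hf.2] at this
    conv_rhs => rw [f.as_sum_range_C_mul_X_pow, hf.2]
    simp [sum_range_succ, h2]
    ring

theorem monicSum_kloostermanPolyChar_one [DecidableEq F] (ψ : AddChar F R) (a : F) :
    monicSum (kloostermanPolyChar ψ a) 1 = ∑ x : F, if x = 0 then 0 else ψ (x + a / x) := by
  rw [monicSum_one_eq]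
  refine Fintype.sum_equiv (Equiv.neg F) _ _ fun c => ?_
  rw [kloostermanPolyChar_X_add_C]
  simp [div_neg, add_comm]

/-- For a fixed constant term c ≠ 0 the linear coefficient b enters as ψ(-b(1 + a/c)), so
orthogonality leaves only c = -a, where every term is 1. -/
theorem monicSum_kloostermanPolyChar_two [IsDomain R] {ψ : AddChar F R} (hψ : ψ.IsPrimitive)
    {a : F} (ha : a ≠ 0) : monicSum (kloostermanPolyChar ψ a) 2 = Fintype.card F := by
  classical
  rw [monicSum_two_eq, sum_eq_single (-a)]
  · simp_rw [kloostermanPolyChar_X_sq_add]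
    simp [ha]
  · intro c _ hc
    simp_rw [kloostermanPolyChar_X_sq_add]
    split_ifs with h
    · simp
    · rw [AddChar.sum_mulShift _ hψ, if_neg]
      · simp
      · rw [neg_eq_zero]
        intro h'
        apply hc
        field_simp at h'
        linear_combination h'
  · simp

/-- For n ≥ 3 the coefficient of X^(n-1) is distinct from those of X and 1, so translating it
permutes the monic polynomials and scales the sum by ψ(u) ≠ 1. -/
theorem monicSum_kloostermanPolyChar_eq_zero [IsDomain R] {ψ : AddChar F R} (hψ : ψ ≠ 1)
    (a : F) {n : ℕ} (hn : 3 ≤ n) : monicSum (kloostermanPolyChar ψ a) n = 0 := by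
  obtain ⟨u, hu⟩ := AddChar.ne_one_iff.1 hψ
  have hmem : ∀ v : F, ∀ f ∈ monicOfDegree F n, f + C v * X ^ (n - 1) ∈ monicOfDegree F n := by
    intro v f hf
    rw [mem_monicOfDegree] at hf ⊢
    have hlt : (C v * X ^ (n - 1)).degree < f.degree := by
      rw [degree_eq_natDegree hf.1.ne_zero, hf.2]
      exact (degree_C_mul_X_pow_le _ _).trans_lt (Nat.cast_lt.2 (by omega))
    exact ⟨hf.1.add_of_left hlt, by rw [natDegree_add_eq_left_of_degree_lt hlt, hf.2]⟩
  have hshift : ∀ f ∈ monicOfDegree F n, kloostermanPolyChar ψ a (f + C (-u) * X ^ (n - 1)) =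
      ψ u * kloostermanPolyChar ψ a f := by
    intro f hf
    have hg := (mem_monicOfDegree.1 (hmem (-u) f hf)).2
    have hf := (mem_monicOfDegree.1 hf).2
    have hcoeff : ∀ k, (f + C (-u) * X ^ (n - 1)).coeff k =
        f.coeff k + if k = n - 1 then -u else 0 := fun k => by
      rw [coeff_add, coeff_C_mul_X_pow]
    unfold kloostermanPolyChar
    rw [nextCoeff_of_natDegree_pos (by omega), nextCoeff_of_natDegree_pos (by omega), hg, hf,
      hcoeff, hcoeff, hcoeff, if_pos rfl, if_neg (show 1 ≠ n - 1 by omega),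
      if_neg (show 0 ≠ n - 1 by omega), add_zero, add_zero]
    by_cases h : f.coeff 0 = 0
    · rw [if_pos h, if_pos h, mul_zero]
    · rw [if_neg h, if_neg h, ← AddChar.map_add_eq_mul]
      congr 1
      ring
  have hsum : monicSum (kloostermanPolyChar ψ a) n =
      ψ u * monicSum (kloostermanPolyChar ψ a) n := by
    conv_rhs => rw [monicSum, mul_sum, ← sum_congr rfl hshift]
    symm
    refine sum_bij (fun f _ => f + C (-u) * X ^ (n - 1)) (hmem _) ?_ ?_ fun _ _ => rfl
    · intro f _ g _ h
      exact add_right_cancel h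
    · intro f hf
      exact ⟨f + C u * X ^ (n - 1), hmem _ _ hf, by simp⟩
  have : (ψ u - 1) * monicSum (kloostermanPolyChar ψ a) n = 0 := by
    linear_combination -hsum
  exact (mul_eq_zero.1 this).resolve_left (sub_ne_zero.2 hu)

theorem primePowerSum_kloostermanPolyChar [IsDomain R] {ψ : AddChar F R} (hψ : ψ.IsPrimitive)
    {a : F} (ha : a ≠ 0) {n : ℕ} (hn : 1 ≤ n) :
    primePowerSum (kloostermanPolyChar ψ a) n =
      -powerSumSeq (-monicSum (kloostermanPolyChar ψ a) 1) (Fintype.card F : R) n := by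
  rw [← monicSum_kloostermanPolyChar_two hψ ha]
  refine eq_neg_powerSumSeq_of_newton (monicSum_zero (kloostermanPolyChar_one ψ a)) ?_
    (natCast_mul_monicSum (kloostermanPolyChar_one ψ a)
      fun f g hf hg => kloostermanPolyChar_mul ψ a hf hg) hn
  intro k hk
  refine monicSum_kloostermanPolyChar_eq_zero ?_ a hk
  rintro rfl
  exact hψ one_ne_zero (by ext; simp)

end PolynomialChar

/-! ### From irreducible polynomials to elements of the extension. -/

section Extension

variable {F L : Type*} [Field F] [Field L] [Algebra F L]

theorem adjoin_simple_inv (x : L) : F⟮x⁻¹⟯ = F⟮x⟯ := by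
  apply le_antisymm <;> rw [adjoin_simple_le_iff]
  · exact inv_mem (mem_adjoin_simple_self F x)
  · simpa using inv_mem (mem_adjoin_simple_self F x⁻¹)

theorem natDegree_minpoly_inv [FiniteDimensional F L] (x : L) :
    (minpoly F x⁻¹).natDegree = (minpoly F x).natDegree := by
  rw [← adjoin.finrank (.of_finite F x), ← adjoin.finrank (.of_finite F x⁻¹), adjoin_simple_inv]

theorem minpoly_inv [FiniteDimensional F L] {x : L} (hx : x ≠ 0) :
    minpoly F x⁻¹ = C ((minpoly F x).coeff 0)⁻¹ * (minpoly F x).reverse := by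
  have h0 : (minpoly F x).coeff 0 ≠ 0 := minpoly.coeff_zero_ne_zero (.of_finite F x) hx
  have hroot : aeval x⁻¹ (minpoly F x).reverse = 0 := by
    let _ := invertibleOfNonzero hx
    have := (eval₂_reverse_eq_zero_iff (algebraMap F L) x (minpoly F x)).2 (minpoly.aeval F x)
    rwa [invOf_eq_inv] at this
  have htrail : (minpoly F x).natTrailingDegree = 0 :=
    natTrailingDegree_eq_zero.2 (Or.inr h0)
  refine (eq_of_monic_of_dvd_of_natDegree_le (minpoly.monic (.of_finite F x⁻¹)) ?_ ?_ ?_).symm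
  · rw [Monic, leadingCoeff_mul, leadingCoeff_C, reverse_leadingCoeff, trailingCoeff, htrail,
      inv_mul_cancel₀ h0]
  · exact minpoly.dvd _ _ (by rw [map_mul, hroot, mul_zero])
  · rw [natDegree_C_mul (inv_ne_zero h0), natDegree_minpoly_inv, reverse_natDegree]
    omega

theorem nextCoeff_minpoly_inv [FiniteDimensional F L] {x : L} (hx : x ≠ 0) :
    (minpoly F x⁻¹).nextCoeff = (minpoly F x).coeff 1 / (minpoly F x).coeff 0 := by
  have hpos : 0 < (minpoly F x).natDegree := minpoly.natDegree_pos (.of_finite F x)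
  rw [nextCoeff_of_natDegree_pos (by rwa [natDegree_minpoly_inv]), natDegree_minpoly_inv,
    minpoly_inv hx, coeff_C_mul, coeff_reverse, revAt_le (Nat.sub_le _ _),
    Nat.sub_sub_self hpos, div_eq_inv_mul]

/-- The trace of x is -[L : F(x)] times the next coefficient of its minimal polynomial. The same
formula for x⁻¹, which generates the same field, involves the reversed polynomial. -/
theorem kloostermanPolyChar_minpoly_pow {R : Type*} [CommRing R] [FiniteDimensional F L]
    (ψ : AddChar F R) (a : F) {x : L} (hx : x ≠ 0) :
    kloostermanPolyChar ψ a (minpoly F x) ^ Module.finrank F⟮x⟯ L =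
      ψ (Algebra.trace F L (x + algebraMap F L a / x)) := by
  rw [kloostermanPolyChar, if_neg (minpoly.coeff_zero_ne_zero (.of_finite F x) hx),
    ← AddChar.map_nsmul_eq_pow, map_add, div_eq_mul_inv (algebraMap F L a), ← Algebra.smul_def,
    map_smul (Algebra.trace F L), smul_eq_mul, trace_eq_finrank_mul_minpoly_nextCoeff,
    trace_eq_finrank_mul_minpoly_nextCoeff, adjoin_simple_inv,
    nextCoeff_minpoly_inv hx]
  congr 1
  simp
  ring

variable [Fintype L]

/-- P divides X^|L| - X, so it splits in L; it is separable because F is perfect. -/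
theorem card_filter_minpoly_eq [DecidableEq F[X]] {P : F[X]} (hP : P.Monic) (hi : Irreducible P)
    (hd : P.natDegree ∣ Module.finrank F L) :
    (univ.filter fun x : L => minpoly F x = P).card = P.natDegree := by
  classical
  have : Finite F := Finite.of_injective _ (algebraMap F L).injective
  have : FiniteDimensional F L := inferInstance
  have hdvd := hi.natDegree_dvd_iff_dvd_X_pow_card_pow_sub_X.1 hd
  rw [← Module.natCard_eq_pow_finrank] at hdvd
  have hsplit : (P.map (algebraMap F L)).Splits := by
    have := Fintype.ofFinite F
    refine Splits.of_dvd ?_ ?_ (Polynomial.map_dvd (algebraMap F L) hdvd)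
    · rw [← Fintype.card_eq_nat_card]
      exact (FiniteField.isSplittingField_sub L F).splits
    · rw [← Fintype.card_eq_nat_card]
      exact Polynomial.map_ne_zero (FiniteField.X_pow_card_sub_X_ne_zero _ Fintype.one_lt_card)
  have hsep : P.Separable := PerfectField.separable_of_irreducible hi
  rw [← card_rootSet_eq_natDegree (K := L) hsep hsplit]
  rw [← Set.toFinset_card]
  congr 1
  ext x
  simp only [mem_filter, mem_univ, true_and, Set.mem_toFinset, mem_rootSet]
  constructor
  · rintro rfl
    exact ⟨hi.ne_zero, minpoly.aeval F x⟩
  · rintro ⟨_, h⟩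
    exact (minpoly.eq_of_irreducible_of_monic hi h hP).symm

/-- The `n`-th logarithmic coefficient of the `L`-function is the Kloosterman sum over the extension
of degree `n`. -/
theorem sum_trace_eq_primePowerSum [Finite F] {R : Type*} [CommRing R] [DecidableEq L]
    (ψ : AddChar F R) (a : F) :
    (∑ x : L, if x = 0 then 0 else ψ (Algebra.trace F L (x + algebraMap F L a / x))) =
      primePowerSum (kloostermanPolyChar ψ a) (Module.finrank F L) := by
  classical
  have hn : Module.finrank F L ≠ 0 := Module.finrank_pos.ne'
  have hterm : ∀ x : L,
      (if x = 0 then 0 else ψ (Algebra.trace F L (x + algebraMap F L a / x))) =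
        kloostermanPolyChar ψ a (minpoly F x) ^ Module.finrank F⟮x⟯ L := by
    intro x
    split_ifs with h
    · rw [kloostermanPolyChar, if_pos (by simp [h, minpoly.zero]),
        zero_pow Module.finrank_pos.ne']
    · rw [kloostermanPolyChar_minpoly_pow ψ a h]
  have hmul : ∀ x : L, (minpoly F x).natDegree * Module.finrank F⟮x⟯ L = Module.finrank F L := by
    intro x
    rw [← adjoin.finrank (.of_finite F x), Module.finrank_mul_finrank]
  have hmaps : ∀ x ∈ (univ : Finset L), ((minpoly F x).natDegree, Module.finrank F⟮x⟯ L) ∈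
      (Module.finrank F L).divisorsAntidiagonal := fun x _ =>
    Nat.mem_divisorsAntidiagonal.2 ⟨hmul x, hn⟩
  rw [sum_congr rfl fun x _ => hterm x, ← sum_fiberwise_of_maps_to hmaps, primePowerSum]
  refine sum_congr rfl fun ⟨d, j⟩ hdj => ?_
  rw [Nat.mem_divisorsAntidiagonal] at hdj
  have hmaps' : ∀ x ∈ univ.filter fun x : L =>
      ((minpoly F x).natDegree, Module.finrank F⟮x⟯ L) = (d, j),
      minpoly F x ∈ irreducibleOfDegree F d := by
    intro x hx
    rw [mem_filter, Prod.mk.injEq] at hx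
    exact mem_irreducibleOfDegree.2
      ⟨⟨minpoly.monic (.of_finite F x), hx.2.1⟩, minpoly.irreducible (.of_finite F x)⟩
  rw [← sum_fiberwise_of_maps_to hmaps']
  refine sum_congr rfl fun P hP => ?_
  obtain ⟨⟨hP1, hP2⟩, hP3⟩ := mem_irreducibleOfDegree.1 hP
  have hset : ((univ.filter fun x : L =>
      ((minpoly F x).natDegree, Module.finrank F⟮x⟯ L) = (d, j)).filter
        fun x => minpoly F x = P) = univ.filter fun x : L => minpoly F x = P := by
    ext x
    simp only [mem_filter, mem_univ, true_and, Prod.mk.injEq, and_iff_right_iff_imp]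
    rintro rfl
    refine ⟨hP2, Nat.eq_of_mul_eq_mul_left (show 0 < d from Nat.pos_of_ne_zero ?_) ?_⟩
    · rintro rfl
      simp at hdj
      exact hdj.2 hdj.1.symm
    · exact (congrArg (· * _) hP2.symm).trans ((hmul x).trans hdj.1.symm)
  have hval : ∀ x ∈ univ.filter fun x : L => minpoly F x = P,
      kloostermanPolyChar ψ a (minpoly F x) ^ Module.finrank F⟮x⟯ L =
        kloostermanPolyChar ψ a P ^ j := by
    intro x hx
    have := hset ▸ hx
    simp only [mem_filter, Prod.mk.injEq] at this
    rw [this.2, this.1.2.2]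
  rw [hset, sum_congr rfl hval, sum_const, card_filter_minpoly_eq hP1 hP3 ⟨j, by rw [hP2, hdj.1]⟩,
    hP2, nsmul_eq_mul]

end Extension

/-! ### Lifting the exponent in ℤ_3. -/

section ThreeAdic

/-- Hensel's lemma at 1 for X² - tX + q: the value 1 - t + q is divisible by 3 and the derivative 2
- t is a unit. -/
theorem exists_padicInt_add_mul_eq {t q : ℤ} (ht : (3 : ℤ) ∣ t - 1) (hq : (3 : ℤ) ∣ q) :
    ∃ α β : ℤ_[3], α + β = t ∧ α * β = q ∧ 3 ∣ α - 1 ∧ 3 ∣ β := by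
  have key : ∀ z : ℤ_[3], 3 ∣ z ↔ ‖z‖ < 1 := fun z => by
    rw [PadicInt.norm_lt_one_iff_dvd]; norm_num
  have hunit : ∀ z : ℤ_[3], 3 ∣ z - 1 → ‖z‖ = 1 := by
    intro z hz
    by_contra h
    have h1 : (3 : ℤ_[3]) ∣ z := (key z).2 (lt_of_le_of_ne (PadicInt.norm_le_one z) h)
    have : (3 : ℤ_[3]) ∣ 1 := by simpa using dvd_sub h1 hz
    rw [key] at this
    simp at this
  have ht' : (3 : ℤ_[3]) ∣ (t : ℤ_[3]) - 1 := by simpa using map_dvd (Int.castRingHom ℤ_[3]) ht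
  have hq' : (3 : ℤ_[3]) ∣ (q : ℤ_[3]) := by simpa using map_dvd (Int.castRingHom ℤ_[3]) hq
  let f : ℤ_[3][X] := X ^ 2 - C (t : ℤ_[3]) * X + C (q : ℤ_[3])
  have hf : ∀ z : ℤ_[3], aeval z f = z ^ 2 - t * z + q := fun z => by simp [f]
  have hf' : ∀ z : ℤ_[3], aeval z (derivative f) = 2 * z - t := fun z => by
    simp [f, one_add_one_eq_two]
  have hn' : ‖aeval (1 : ℤ_[3]) (derivative f)‖ = 1 := by
    rw [hf']
    refine hunit _ ?_
    rw [show (2 * 1 - (t : ℤ_[3]) - 1) = -(t - 1) by ring]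
    exact (dvd_neg).2 ht'
  have hn : ‖aeval (1 : ℤ_[3]) f‖ < ‖aeval (1 : ℤ_[3]) (derivative f)‖ ^ 2 := by
    rw [hn', one_pow, ← key, hf, show (1 ^ 2 - (t : ℤ_[3]) * 1 + q) = q - (t - 1) by ring]
    exact dvd_sub hq' ht'
  obtain ⟨α, hα, hα1, -⟩ := hensels_lemma hn
  rw [hn', ← key] at hα1
  rw [hf] at hα
  refine ⟨α, t - α, by ring, by linear_combination -hα, hα1, ?_⟩
  rw [show (t - α : ℤ_[3]) = (t - 1) - (α - 1) by ring]
  exact dvd_sub ht' hα1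

theorem isUnit_of_three_dvd_sub {z : ℤ_[3]} {s : ℕ} (hs : Nat.Coprime 3 s) (h : 3 ∣ z - s) :
    IsUnit z := by
  rw [PadicInt.isUnit_iff]
  by_contra hz
  have h1 : (3 : ℤ_[3]) ∣ z := by
    have := (PadicInt.norm_lt_one_iff_dvd z).1 (lt_of_le_of_ne (PadicInt.norm_le_one z) hz)
    exact_mod_cast this
  have h2 : (3 : ℤ_[3]) ∣ (s : ℤ) := by
    have := dvd_sub h1 h
    simpa using this
  have h3 : (3 : ℤ) ∣ s := by
    have := (PadicInt.pow_p_dvd_int_iff (p := 3) 1 s).1 (by simpa using h2)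
    simpa using this
  have := Nat.dvd_gcd dvd_rfl (Int.natCast_dvd_natCast.1 h3)
  rw [hs] at this
  norm_num at this

theorem three_dvd_pow_sub_one {R : Type*} [CommRing R] {α : R} (hα : 3 ∣ α - 1) (n : ℕ) : 3 ∣ α ^ n - 1 :=
  hα.trans (by simpa using sub_dvd_pow_sub_pow α 1 n)

/-- With α = 1 + 3y, α³ - 1 = 9y(1 + 3y + 3y²), and the last factor is a unit. -/
theorem associated_pow_three_sub_one {α : ℤ_[3]} (hα : 3 ∣ α - 1) :
    Associated (3 * (α - 1)) (α ^ 3 - 1) := by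
  obtain ⟨y, hy⟩ := hα
  have hu : IsUnit (1 + 3 * y + 3 * y ^ 2) :=
    isUnit_of_three_dvd_sub (s := 1) (by norm_num) ⟨y + y ^ 2, by push_cast; ring⟩
  refine ⟨hu.unit, ?_⟩
  rw [IsUnit.unit_spec, show α = 1 + 3 * y by linear_combination hy]
  ring

theorem associated_pow_three_pow_sub_one {α : ℤ_[3]} (hα : 3 ∣ α - 1) (h : ℕ) :
    Associated (3 ^ h * (α - 1)) (α ^ 3 ^ h - 1) := by
  induction h with
  | zero => simp
  | succ h ih =>
    rw [pow_succ' (3 : ℤ_[3]), mul_assoc, pow_succ 3 h, pow_mul]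
    exact (ih.mul_left 3).trans
      (associated_pow_three_sub_one (three_dvd_pow_sub_one hα (3 ^ h)))

/-- The quotient is a geometric sum congruent to s mod 3, hence a unit. -/
theorem associated_pow_coprime_sub_one {α : ℤ_[3]} (hα : 3 ∣ α - 1) {s : ℕ}
    (hs : Nat.Coprime 3 s) : Associated (α - 1) (α ^ s - 1) := by
  have hu : IsUnit (∑ i ∈ range s, α ^ i) := by
    refine isUnit_of_three_dvd_sub hs ?_
    have : ∑ i ∈ range s, α ^ i - s = ∑ i ∈ range s, (α ^ i - 1) := by simp
    rw [this]
    exact dvd_sum fun i _ => three_dvd_pow_sub_one hα i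
  refine ⟨hu.unit, ?_⟩
  rw [IsUnit.unit_spec, mul_geom_sum]

/-- If `α + β = t` and `α * β = q`, the numbers `(1 - α ^ n) * (1 - β ^ n)` and
`n * (1 - α) * (1 - β)` are divisible by the same powers of `3`. -/
theorem three_pow_dvd_iff {t q : ℤ} (ht : (3 : ℤ) ∣ t - 1) (hq : (3 : ℤ) ∣ q) (h : ℕ) {s : ℕ}
    (hs : Nat.Coprime 3 s) (k : ℕ) :
    (3 : ℤ) ^ k ∣ 1 - powerSumSeq t q (3 ^ h * s) + q ^ (3 ^ h * s) ↔
      (3 : ℤ) ^ k ∣ 3 ^ h * (1 - t + q) := by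
  obtain ⟨α, β, hadd, hmul, hα, hβ⟩ := exists_padicInt_add_mul_eq ht hq
  have hunit : ∀ n, n ≠ 0 → IsUnit (1 - β ^ n) := fun n hn =>
    isUnit_of_three_dvd_sub (s := 1) (by norm_num) (by simpa using dvd_pow hβ hn)
  have hs0 : s ≠ 0 := by rintro rfl; norm_num at hs
  have hn0 : 3 ^ h * s ≠ 0 := by positivity
  have hassoc : Associated ((3 : ℤ_[3]) ^ h * ((1 - α) * (1 - β)))
      ((1 - α ^ (3 ^ h * s)) * (1 - β ^ (3 ^ h * s))) := by
    have h1 := (associated_pow_three_pow_sub_one hα h).trans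
      (associated_pow_coprime_sub_one (three_dvd_pow_sub_one hα (3 ^ h)) hs)
    rw [← pow_mul] at h1
    have h2 := h1.neg_left.neg_right
    rw [← mul_neg, neg_sub, neg_sub] at h2
    rw [← mul_assoc]
    exact h2.mul_mul ((associated_one_iff_isUnit.2 (by simpa using hunit 1 one_ne_zero)).trans
      (associated_one_iff_isUnit.2 (hunit _ hn0)).symm)
  have hdvd : ∀ z : ℤ, (3 : ℤ) ^ k ∣ z ↔ (3 : ℤ_[3]) ^ k ∣ z := fun z => by
    simpa using (PadicInt.pow_p_dvd_int_iff (p := 3) k z).symm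
  rw [hdvd, hdvd]
  have e1 : ((1 - powerSumSeq t q (3 ^ h * s) + q ^ (3 ^ h * s) : ℤ) : ℤ_[3]) =
      (1 - α ^ (3 ^ h * s)) * (1 - β ^ (3 ^ h * s)) := by
    have := map_powerSumSeq (Int.castRingHom ℤ_[3]) t q (3 ^ h * s)
    simp only [eq_intCast] at this
    push_cast
    rw [this, ← hadd, ← hmul, powerSumSeq_add_mul, mul_pow]
    ring
  have e2 : ((3 ^ h * (1 - t + q) : ℤ) : ℤ_[3]) = (3 : ℤ_[3]) ^ h * ((1 - α) * (1 - β)) := by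
    push_cast
    rw [← hadd, ← hmul]
    ring
  rw [e1, e2]
  exact hassoc.dvd_iff_dvd_right.symm

end ThreeAdic

/-! ### Integrality, size and the lifting relation for Kloosterman sums. -/

section CubicCharacter

/-- Negation pairs the fibres over 1 and 2, both of size B, and ω + ω² = -1. The fibre over 0
contains 0, which makes the bound on B strict. -/
theorem exists_sum_pow_val_eq {ω : ℂ} (hω : IsPrimitiveRoot ω 3) {X : Type*} [AddGroup X]
    [Fintype X] (y : X → ZMod 3) (hy0 : y 0 = 0) (hy : ∀ x, y (-x) = -y x) :
    ∃ B : ℕ, 2 * B < Fintype.card X ∧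
      ∑ x, ω ^ (y x).val = ((Fintype.card X - 3 * B : ℤ) : ℂ) := by
  classical
  let N : ZMod 3 → ℕ := fun v => (univ.filter fun x => y x = v).card
  have hcard : Fintype.card X = N 0 + N 1 + N 2 := by
    rw [← Finset.card_univ, card_eq_sum_card_fiberwise (f := y) (t := univ) (by simp)]
    exact Fin.sum_univ_three _
  have hsum : ∑ x, ω ^ (y x).val = N 0 + N 1 * ω + N 2 * ω ^ 2 := by
    rw [← sum_fiberwise univ y]
    have : ∀ v : ZMod 3, ∑ x with y x = v, ω ^ (y x).val = N v * ω ^ v.val := by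
      intro v
      rw [sum_congr rfl fun x hx => by rw [(mem_filter.1 hx).2], sum_const, nsmul_eq_mul]
    rw [sum_congr rfl fun v _ => this v]
    refine (Fin.sum_univ_three _).trans ?_
    simp [ZMod.val]
    rfl
  have hsymm : N 1 = N 2 := by
    refine card_bij (fun x _ => -x) ?_ ?_ ?_
    · intro x hx
      rw [mem_filter] at hx ⊢
      refine ⟨mem_univ _, ?_⟩
      rw [hy, hx.2]
      decide
    · intro x _ x' _ h
      exact neg_injective h
    · intro x hx
      rw [mem_filter] at hx
      refine ⟨-x, ?_, neg_neg x⟩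
      rw [mem_filter]
      refine ⟨mem_univ _, ?_⟩
      rw [hy, hx.2]
      decide
  have hpos : 0 < N 0 := card_pos.2 ⟨0, by simp [hy0]⟩
  have hroot : 1 + ω + ω ^ 2 = 0 := by
    have := hω.geom_sum_eq_zero (by norm_num)
    simpa [sum_range_succ] using this
  refine ⟨N 1, by omega, ?_⟩
  rw [hsum, hcard, ← hsymm]
  push_cast
  linear_combination (N 1 : ℂ) * hroot

/-- `kloostermanChar` as an additive character. -/
def kloostermanAddChar {ω : ℂ} (hω : IsPrimitiveRoot ω 3) (F : Type*) [Field F]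
    [Algebra (ZMod 3) F] : AddChar F ℂ :=
  (AddChar.zmodChar 3 hω.pow_eq_one).compAddMonoidHom (Algebra.trace (ZMod 3) F).toAddMonoidHom

variable {ω : ℂ} (hω : IsPrimitiveRoot ω 3) {F L : Type*} [Field F] [Algebra (ZMod 3) F]
  [Field L] [Algebra F L] [Fintype L]

theorem kloostermanAddChar_apply (x : F) : kloostermanAddChar hω F x = kloostermanChar ω x := by
  simp [kloostermanAddChar, kloostermanChar, AddChar.zmodChar_apply]

include hω in
theorem exists_kloostermanSumLift_eq (a : F) :
    ∃ B : ℕ, 2 * B < Fintype.card L ∧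
      kloostermanSumLift ω L a = ((Fintype.card L - 3 * B : ℤ) : ℂ) := by
  refine exists_sum_pow_val_eq hω
    (fun x : L => Algebra.trace (ZMod 3) F (Algebra.trace F L (x + algebraMap F L a / x)))
    (by simp) fun x => ?_
  rw [← map_neg, ← map_neg]
  congr 2
  rw [div_neg]
  ring

theorem kloostermanSumLift_eq_one_add_sum [DecidableEq L] (a : F) :
    kloostermanSumLift ω L a = 1 + ∑ x : L, if x = 0 then 0 else
      kloostermanAddChar hω F (Algebra.trace F L (x + algebraMap F L a / x)) := by
  have : (1 : ℂ) = ∑ x : L, if x = 0 then 1 else 0 := by simp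
  rw [this, ← sum_add_distrib, kloostermanSumLift]
  refine sum_congr rfl fun x _ => ?_
  rw [kloostermanCharLift, ← kloostermanAddChar_apply hω]
  split_ifs with h <;> simp [h]

variable [Fintype F]

theorem isPrimitive_kloostermanAddChar : (kloostermanAddChar hω F).IsPrimitive := by
  refine AddChar.IsPrimitive.of_ne_one ?_
  have : Fact (Nat.Prime 3) := ⟨Nat.prime_three⟩
  obtain ⟨x, hx⟩ := Algebra.trace_surjective (ZMod 3) F 1
  refine AddChar.ne_one_iff.2 ⟨x, ?_⟩
  rw [kloostermanAddChar_apply, kloostermanChar, hx, ZMod.val_one, pow_one]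
  exact hω.ne_one (by norm_num)

theorem kloostermanSumLift_self (a : F) : kloostermanSumLift ω F a = kloostermanSum ω a := by
  simp [kloostermanSumLift, kloostermanSum, kloostermanCharLift]

include hω in
theorem kloostermanSumLift_eq_one_sub_powerSumSeq {a : F} (ha : a ≠ 0) :
    kloostermanSumLift ω L a =
      1 - powerSumSeq (1 - kloostermanSum ω a) (Fintype.card F : ℂ) (Module.finrank F L) := by
  classical
  have h1 : kloostermanSum ω a =
      1 + monicSum (kloostermanPolyChar (kloostermanAddChar hω F) a) 1 := by
    rw [← kloostermanSumLift_self, kloostermanSumLift_eq_one_add_sum hω,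
      monicSum_kloostermanPolyChar_one]
    simp
  rw [kloostermanSumLift_eq_one_add_sum hω, sum_trace_eq_primePowerSum,
    primePowerSum_kloostermanPolyChar (isPrimitive_kloostermanAddChar hω) ha Module.finrank_pos, h1,
    sub_add_cancel_left, sub_eq_add_neg]

end CubicCharacter

/-! ### Absorbing the convention at zero. -/

section Exponent

theorem threeExponent_intCast {d : ℕ} {c : ℤ} (hc : c ≠ 0) (k : ℕ) :
    k ≤ threeExponent d c ↔ (3 : ℤ) ^ k ∣ c := by
  have hfin : FiniteMultiplicity 3 c := Int.finiteMultiplicity_iff.2 ⟨by norm_num, hc⟩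
  have hset : {k : ℕ | ∃ e : ℤ, (c : ℂ) = 3 ^ k * (e : ℂ)} = Set.Iic (multiplicity 3 c) := by
    ext k
    rw [Set.mem_Iic, ← hfin.pow_dvd_iff_le_multiplicity]
    exact ⟨fun ⟨e, he⟩ => ⟨e, by exact_mod_cast he⟩, fun ⟨e, he⟩ => ⟨e, by rw [he]; push_cast; rfl⟩⟩
  rw [threeExponent, if_neg (Int.cast_ne_zero.2 hc), hset, csSup_Iic,
    hfin.pow_dvd_iff_le_multiplicity]

/-- Adding 3^d can only disturb the valuation when 3^d divides c. The bounds then leave c = 0, where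
the convention gives d, and c = 3^d, where the sum is 2 · 3^d. -/
theorem le_threeExponent_iff {d : ℕ} {c : ℤ} (h1 : -3 ^ d < c) (h2 : c ≤ 3 ^ d) (k : ℕ) :
    k ≤ threeExponent d c ↔ (3 : ℤ) ^ k ∣ c + 3 ^ d := by
  rcases eq_or_ne c 0 with rfl | hc
  · rw [threeExponent, if_pos Int.cast_zero, zero_add, pow_dvd_pow_iff (by norm_num)]
    exact Int.prime_three.not_isUnit
  rw [threeExponent_intCast hc]
  by_cases hd : (3 : ℤ) ^ d ∣ c
  · obtain ⟨u, rfl⟩ := hd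
    have hpos : (0 : ℤ) < 3 ^ d := by positivity
    have hu : u = 1 := by
      have : -1 < u := by nlinarith
      have : u ≤ 1 := by nlinarith
      have : u ≠ 0 := by rintro rfl; simp at hc
      omega
    subst hu
    rw [mul_one, ← two_mul]
    exact ⟨fun h => h.mul_left 2, fun h => IsCoprime.dvd_of_dvd_mul_left
      (IsCoprime.pow_left (by norm_num)) h⟩
  · rcases le_total k d with hk | hk
    · exact (dvd_add_left (pow_dvd_pow 3 hk)).symm
    · refine ⟨fun h => absurd ((pow_dvd_pow 3 hk).trans h) hd, fun h => absurd ?_ hd⟩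
      exact (dvd_add_left dvd_rfl).1 ((pow_dvd_pow 3 hk).trans h)

end Exponent

end

theorem theorem2 {F : Type*} {L : Type*} [Field F] [Fintype F] [Algebra (ZMod 3) F]
    [Field L] [Fintype L] [Algebra F L]
    (ω : ℂ) (hω : IsPrimitiveRoot ω 3)
    (m n h s : ℕ) (hF : Fintype.card F = 3 ^ m) (hL : Module.finrank F L = n)
    (hn : n = 3 ^ h * s) (hn2 : 2 ≤ n) (hs : Nat.Coprime 3 s)
    (a : F) (ha : a ≠ 0) :
    (∃ c : ℤ, kloostermanSum ω a = (c : ℂ)) ∧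
    (∃ c : ℤ, kloostermanSumLift ω L a = (c : ℂ)) ∧
    threeExponent (m * n) (kloostermanSumLift ω L a) =
      threeExponent m (kloostermanSum ω a) + h := by
  obtain ⟨B, hB, hK⟩ := exists_kloostermanSumLift_eq hω (L := F) a
  obtain ⟨B', hB', hK'⟩ := exists_kloostermanSumLift_eq hω (L := L) a
  have hrel := kloostermanSumLift_eq_one_sub_powerSumSeq hω (L := L) ha
  rw [kloostermanSumLift_self] at hK
  have hcard : Fintype.card L = 3 ^ (m * n) := by
    rw [Module.card_eq_pow_finrank (K := F), hF, hL, pow_mul]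
  have hm : m ≠ 0 := by
    rintro rfl
    have := Fintype.one_lt_card (α := F)
    omega
  rw [hF] at hB hK hrel
  rw [hcard] at hB' hK'
  rw [hL] at hrel
  generalize hc : ((3 ^ m : ℕ) - 3 * B : ℤ) = c at hK
  generalize hc' : ((3 ^ (m * n) : ℕ) - 3 * B' : ℤ) = c' at hK'
  push_cast at hc hc'
  refine ⟨⟨c, hK⟩, ⟨c', hK'⟩, ?_⟩
  have hB1 : (2 * B : ℤ) < 3 ^ m := by exact_mod_cast hB
  have hB2 : (2 * B' : ℤ) < 3 ^ (m * n) := by exact_mod_cast hB'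
  have hint : c' = 1 - powerSumSeq (1 - c) (3 ^ m) n := by
    rw [hK, hK'] at hrel
    have hmap := map_powerSumSeq (Int.castRingHom ℂ) (1 - c) (3 ^ m) n
    simp only [eq_intCast] at hmap
    push_cast at hmap hrel
    rw [← hmap] at hrel
    exact_mod_cast hrel
  have h3 : (3 : ℤ) ∣ 3 ^ m := dvd_pow_self 3 hm
  have ht : (3 : ℤ) ∣ 1 - c - 1 := by
    rw [sub_sub_cancel_left, dvd_neg, ← hc]
    exact dvd_sub h3 (dvd_mul_right 3 _)
  have hkey : ∀ k, k ≤ threeExponent (m * n) (kloostermanSumLift ω L a) ↔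
      (3 : ℤ) ^ k ∣ 3 ^ h * (c + 3 ^ m) := by
    intro k
    rw [hK', le_threeExponent_iff (by omega) (by omega), hint, hn, pow_mul,
      three_pow_dvd_iff ht h3 h hs, sub_sub_cancel]
  -- Cancelling 3^h compares the two exponents; taking k = H(a) and k = H(a) + 1 then pins down
  -- H_n(a).
  have hkey' : ∀ k, h + k ≤ threeExponent (m * n) (kloostermanSumLift ω L a) ↔
      k ≤ threeExponent m (kloostermanSum ω a) := by
    intro k
    rw [hkey, hK, le_threeExponent_iff (by omega) (by omega), pow_add,
      mul_dvd_mul_iff_left (by positivity)]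
  have h1 := (hkey' _).2 le_rfl
  have h2 := (hkey' (threeExponent m (kloostermanSum ω a) + 1)).not.2 (by omega)
  omega
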